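/- Let $n\ge 0$ and let $A,B,X$ be complex $n\times n$ matrices such that the $2n\times 2n$ block matrix $\begin{bmatrix} A & X\\ X^* & B\end{bmatrix}$ is positive semidefinite. Let $\diamond\in\{+,\circ\}$, where $+$ is the sum and $\circ$ is the Schur (entrywise) product of matrices. Then for every real $\alpha>0$ and every unitarily invariant norm $\|\cdot\|$ on the space of complex $n\times n$ matrices (that is, every norm with $\|UMV\|=\|M\|$ for all matrices $M$ and all unitary matrices $U,V$), $$\big\|\,|X\diamond X^*|^{\alpha}\big\|\le \big\|(A\diamond B)^{\alpha}\big\|,$$ where $|M|=(M^*M)^{1/2}$, and $P^{\alpha}$ denotes the usual power of a positive semidefinite matrix $P$, defined by the functional calculus with $0^\alpha=0$ (the matrix $A\diamond B$ is positive semidefinite). -/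

import Mathlib

open scoped Matrix MatrixOrder ComplexOrder

/-- A unitarily invariant norm on the space of complex `n × n` matrices: a norm
(a seminorm vanishing only at `0`) with `N (U * M * V) = N M` for all unitary `U`, `V`. -/
structure IsUnitarilyInvariantNorm {n : ℕ} (N : Seminorm ℂ (Matrix (Fin n) (Fin n) ℂ)) :
    Prop where
  eq_zero_of_map_eq_zero : ∀ M : Matrix (Fin n) (Fin n) ℂ, N M = 0 → M = 0
  map_unitary_mul_mul : ∀ U ∈ Matrix.unitaryGroup (Fin n) ℂ, ∀ V ∈ Matrix.unitaryGroup (Fin n) ℂ,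
    ∀ M : Matrix (Fin n) (Fin n) ℂ, N (U * M * V) = N M

/-- The two operations allowed as `⋄`: the sum and the Schur (entrywise) product. -/
inductive MatrixOp
  | sum
  | schur

/-- The matrix `A ⋄ B`, where `⋄` is either `+` or the Schur product. -/
def MatrixOp.apply {n : ℕ} (d : MatrixOp) (A B : Matrix (Fin n) (Fin n) ℂ) :
    Matrix (Fin n) (Fin n) ℂ :=
  match d with
  | .sum => A + B
  | .schur => A ⊙ B

/-! Swapping the two diagonal blocks of the hypothesis and combining the result with the original by
`⋄` gives `[P, H; H, P] ≥ 0` with `P = A ⋄ B` and `H = X ⋄ Xᴴ` Hermitian. In an eigenbasis of `H`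
every principal minor of `P` bounds the corresponding product of `|eigenvalues of H|`, while a `k ×
k` principal minor of `P` is at most the product of its `k` largest eigenvalues. So `|H|` is weakly
log-majorized by `P`, and powers `α > 0` preserve this (`prod_abs_le_prod_of_antitone`). Weak
log-majorization implies weak majorization, which by Hahn–Banach places one spectrum in the convex
hull of the signed permutations of the other (`mem_convexHull_signedPerms`). A unitarily invariant
norm is convex and blind to signed permutations of a diagonal, so it respects this order. -/

namespace Matrix

/-! ### Determinant inequalities for positive matrices -/

section Det

variable {m l : Type*} [Fintype m] [DecidableEq m] [Fintype l] [DecidableEq l]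

theorem PosSemidef.one_le_det_one_add {M : Matrix m m ℂ} (hM : M.PosSemidef) :
    1 ≤ (1 + M).det := by
  set U := hM.1.eigenvectorUnitary
  have hU : (U : Matrix m m ℂ) * star (U : Matrix m m ℂ) = 1 := Unitary.coe_mul_star_self U
  have key : 1 + M = (U : Matrix m m ℂ) *
      diagonal (fun i => 1 + (hM.1.eigenvalues i : ℂ)) * star (U : Matrix m m ℂ) := by
    have h1 : diagonal (fun i => 1 + (hM.1.eigenvalues i : ℂ)) =
        1 + diagonal (RCLike.ofReal ∘ hM.1.eigenvalues : m → ℂ) := by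
      rw [← diagonal_one, diagonal_add]; rfl
    rw [h1, mul_add, add_mul, mul_one, hU]
    congr 1
    exact hM.1.spectral_theorem
  have hdet : (U : Matrix m m ℂ).det * (star (U : Matrix m m ℂ)).det = 1 := by
    rw [← det_mul, hU, det_one]
  rw [key, det_mul, det_mul, mul_right_comm, hdet, one_mul, det_diagonal]
  have : (∏ i, (1 + (hM.1.eigenvalues i : ℂ))) = ((∏ i, (1 + hM.1.eigenvalues i) : ℝ) : ℂ) := by
    push_cast; rfl
  rw [this]
  have h2 : (1 : ℝ) ≤ ∏ i, (1 + hM.1.eigenvalues i) :=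
    Finset.prod_const_one.symm.trans_le (Finset.prod_le_prod (fun _ _ => zero_le_one) fun i _ => by
      linarith [hM.eigenvalues_nonneg i])
  exact_mod_cast h2

theorem PosDef.det_le_det_add {Q C : Matrix m m ℂ} (hQ : Q.PosDef) (hC : C.PosSemidef) :
    Q.det ≤ (Q + C).det := by
  obtain ⟨B, rfl⟩ := CStarAlgebra.nonneg_iff_eq_star_mul_self.mp hQ.posSemidef.nonneg
  have hB : IsUnit B.det := by
    have := hQ.det_pos.ne'
    rw [det_mul] at this
    exact (right_ne_zero_of_mul this).isUnit
  have hB' : IsUnit (star B).det := by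
    have := hQ.det_pos.ne'
    rw [det_mul] at this
    exact (left_ne_zero_of_mul this).isUnit
  have hsd : (B⁻¹ᴴ * C * B⁻¹).PosSemidef := hC.conjTranspose_mul_mul_same _
  have e : star B * B + C = star B * (1 + B⁻¹ᴴ * C * B⁻¹) * B := by
    rw [mul_add, add_mul, mul_one]
    congr 1
    rw [mul_assoc, mul_assoc, mul_assoc, nonsing_inv_mul _ hB, mul_one, ← mul_assoc,
      conjTranspose_nonsing_inv, ← star_eq_conjTranspose, mul_nonsing_inv _ hB', one_mul]
  rw [e, det_mul _ B, det_mul _ B, det_mul (star B), mul_right_comm, ← det_mul]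
  exact le_mul_of_one_le_right hQ.det_pos.le hsd.one_le_det_one_add

/-- If `M` is positive semidefinite and `Q - M` is positive semidefinite, then `det M ≤ det Q`. -/
theorem PosSemidef.det_le_det {M Q : Matrix m m ℂ} (hM : M.PosSemidef)
    (h : (Q - M).PosSemidef) : M.det ≤ Q.det := by
  by_cases hd : M.det = 0
  · rw [hd]
    have := hM.add h
    rw [add_sub_cancel] at this
    exact this.det_nonneg
  · have := (hM.posDef_iff_det_ne_zero.2 hd).det_le_det_add h
    rwa [add_sub_cancel] at this

/-- A principal minor of a positive definite matrix bounded below by `t` is controlled by the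
determinant of the matrix. -/
theorem det_mul_pow_le_det_fromBlocks {Q : Matrix m m ℂ} {R : Matrix m l ℂ} {S : Matrix l l ℂ}
    (hQ : Q.PosDef) {t : ℝ} (ht : 0 ≤ t)
    (h : (fromBlocks Q R Rᴴ (S - (t : ℂ) • 1)).PosSemidef) :
    Q.det * (t : ℂ) ^ Fintype.card l ≤ (fromBlocks Q R Rᴴ S).det := by
  let := hQ.isUnit.invertible
  rw [det_fromBlocks₁₁, invOf_eq_nonsing_inv]
  refine mul_le_mul_of_nonneg_left ?_ hQ.det_pos.le
  have h1 := (hQ.fromBlocks₁₁ _ _).1 h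
  have h2 : ((t : ℂ) • (1 : Matrix l l ℂ)).PosSemidef :=
    PosSemidef.one.smul (by exact_mod_cast ht)
  have h3 := h2.det_le_det (Q := S - Rᴴ * Q⁻¹ * R) (by rwa [sub_right_comm])
  simpa [det_smul] using h3

/-- Subtracting `t` only on the coordinates outside `s` keeps `P` positive semidefinite, so the
Schur complement of the `s`-block is at least `t` and has determinant at least `t ^ (card m - card
s)`. -/
theorem PosDef.det_submatrix_mul_pow_le {P : Matrix m m ℂ} (hP : P.PosDef) {t : ℝ} (ht : 0 ≤ t)
    (h : (P - (t : ℂ) • 1).PosSemidef) (s : Finset m) :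
    (P.submatrix ((↑) : s → m) (↑)).det * (t : ℂ) ^ (Fintype.card m - s.card) ≤ P.det := by
  set e := Equiv.sumCompl (· ∈ s)
  have he : P.submatrix e e = fromBlocks (P.submatrix ((↑) : s → m) (↑))
      (P.submatrix ((↑) : s → m) ((↑) : {x // x ∉ s} → m))
      (P.submatrix ((↑) : s → m) ((↑) : {x // x ∉ s} → m))ᴴ
      (P.submatrix ((↑) : {x // x ∉ s} → m) (↑)) := by
    rw [conjTranspose_submatrix, hP.1.eq]
    ext (i | i) (j | j) <;> rfl
  have h1 : (P - (t : ℂ) • (fromBlocks 0 0 0 1 :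
      Matrix (s ⊕ {x // x ∉ s}) (s ⊕ {x // x ∉ s}) ℂ).submatrix e.symm e.symm).PosSemidef := by
    have hone : (1 : Matrix m m ℂ) = (fromBlocks 1 0 0 1 :
      Matrix (s ⊕ {x // x ∉ s}) (s ⊕ {x // x ∉ s}) ℂ).submatrix e.symm e.symm := by
      rw [fromBlocks_one, submatrix_one_equiv]
    have hd : (fromBlocks 1 0 0 0 :
        Matrix (s ⊕ {x // x ∉ s}) (s ⊕ {x // x ∉ s}) ℂ).PosSemidef := by
      have : (fromBlocks 1 0 0 0 : Matrix (s ⊕ {x // x ∉ s}) (s ⊕ {x // x ∉ s}) ℂ) =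
          diagonal (Sum.elim 1 0) := by
        rw [← diagonal_one, ← diagonal_zero, fromBlocks_diagonal]; rfl
      rw [this]
      exact PosSemidef.diagonal (by rintro (i | i) <;> simp)
    have h2 := h.add ((hd.submatrix e.symm).smul (a := (t : ℂ)) (by exact_mod_cast ht))
    convert h2 using 1
    rw [hone, sub_add, ← smul_sub]
    congr 2
    ext i j
    simp only [submatrix_apply, sub_apply]
    rcases e.symm i with i | i <;> rcases e.symm j with j | j <;> simp
  have h2 := h1.submatrix e
  have h3 := det_mul_pow_le_det_fromBlocks (t := t) (hP.submatrix Subtype.coe_injective) ht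
    (R := P.submatrix ((↑) : s → m) ((↑) : {x // x ∉ s} → m))
    (S := P.submatrix ((↑) : {x // x ∉ s} → m) (↑)) (by
      convert h2 using 1
      rw [submatrix_sub]
      change _ = P.submatrix e e - _
      rw [he, submatrix_smul]
      ext (i | i) (j | j) <;> simp)
  rw [← he, det_submatrix_equiv_self] at h3
  have hc : Fintype.card {x // x ∉ s} = Fintype.card m - s.card := by
    rw [Fintype.card_subtype_compl, Fintype.card_coe]
  rwa [hc] at h3

/-- The Schur complement gives `Dᴴ Q⁻¹ D ≤ Q`; taking determinants, `|det D|² ≤ (det Q)²`. -/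
theorem norm_det_le_of_fromBlocks_posSemidef {Q D : Matrix m m ℂ} (hQ : Q.PosDef)
    (h : (fromBlocks Q D Dᴴ Q).PosSemidef) : (‖D.det‖ : ℂ) ≤ Q.det := by
  let := hQ.isUnit.invertible
  have h1 := (hQ.fromBlocks₁₁ _ _).1 h
  have h2 := (hQ.inv.posSemidef.conjTranspose_mul_mul_same D).det_le_det h1
  have hpos := hQ.det_pos
  rw [det_mul, det_mul, det_conjTranspose, det_nonsing_inv, Ring.inverse_eq_inv',
    mul_right_comm] at h2
  have hre : Q.det = ((Q.det.re : ℝ) : ℂ) := by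
    apply Complex.ext <;> simp [← (Complex.pos_iff.1 hpos).2]
  rw [hre] at h2 hpos ⊢
  rw [Complex.star_def, Complex.conj_mul'] at h2
  norm_cast at h2 hpos ⊢
  rw [← div_eq_mul_inv, div_le_iff₀ hpos, ← sq] at h2
  exact le_of_sq_le_sq h2 hpos.le

end Det
end Matrix

/-! ### Majorization of real vectors -/

/-- Abel summation, with `key` as the strengthened induction claim. -/
theorem Finset.sum_range_mul_nonneg_of_antitone {w a : ℕ → ℝ} (hw : Antitone w)
    (hw0 : ∀ i, 0 ≤ w i) {n : ℕ} (ha : ∀ k ≤ n, 0 ≤ ∑ i ∈ Finset.range k, a i) :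
    0 ≤ ∑ i ∈ Finset.range n, w i * a i := by
  have key : ∀ k ≤ n, w k * ∑ i ∈ Finset.range k, a i ≤ ∑ i ∈ Finset.range k, w i * a i := by
    intro k
    induction k with
    | zero => simp
    | succ k ih =>
      intro hk
      calc w (k + 1) * ∑ i ∈ Finset.range (k + 1), a i
          ≤ w k * ∑ i ∈ Finset.range (k + 1), a i :=
            mul_le_mul_of_nonneg_right (hw k.le_succ) (ha _ hk)
        _ ≤ _ := by
            rw [Finset.sum_range_succ, Finset.sum_range_succ, mul_add]
            linarith [ih (by omega)]
  exact (mul_nonneg (hw0 n) (ha n le_rfl)).trans (key n le_rfl)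

/-- Log-majorization implies the inequality of sums with decreasing weights. -/
theorem Finset.sum_range_mul_le_of_prod_le {c x y : ℕ → ℝ} (hc : Antitone c) (hc0 : ∀ i, 0 ≤ c i)
    (hx : Antitone x) (hx0 : ∀ i, 0 ≤ x i) (hy0 : ∀ i, 0 ≤ y i) {n : ℕ}
    (h : ∀ k ≤ n, ∏ i ∈ Finset.range k, x i ≤ ∏ i ∈ Finset.range k, y i) :
    ∑ i ∈ Finset.range n, c i * x i ≤ ∑ i ∈ Finset.range n, c i * y i := by
  -- The value `0` where `x` vanishes is harmless: `x` is antitone, so it stays zero from there on.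
  -- Abel summation is applied with weights `c i * x i`, and `x log (y / x) ≤ y - x` finishes.
  set a : ℕ → ℝ := fun i => if 0 < x i then Real.log (y i) - Real.log (x i) else 0 with ha
  have hypos : ∀ k < n, 0 < x k → ∀ i ≤ k, 0 < x i ∧ 0 < y i := by
    intro k hk hxk i hi
    have hxp : ∀ j ≤ k, 0 < x j := fun j hj => hxk.trans_le (hx hj)
    refine ⟨hxp i hi, (hy0 i).lt_of_ne fun h0 => ?_⟩
    have h1 : 0 < ∏ j ∈ Finset.range (k + 1), x j :=
      Finset.prod_pos fun j hj => hxp j (by simpa [Nat.lt_succ_iff] using hj)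
    have h2 : ∏ j ∈ Finset.range (k + 1), y j = 0 :=
      Finset.prod_eq_zero (i := i) (by simpa [Nat.lt_succ_iff] using hi) h0.symm
    linarith [h (k + 1) hk]
  have hA : ∀ k ≤ n, 0 ≤ ∑ i ∈ Finset.range k, a i := by
    intro k
    induction k with
    | zero => simp
    | succ k ih =>
      intro hk
      by_cases hxk : 0 < x k
      · have hp := hypos k hk hxk
        have e : ∑ i ∈ Finset.range (k + 1), a i = Real.log (∏ i ∈ Finset.range (k + 1), y i)
            - Real.log (∏ i ∈ Finset.range (k + 1), x i) := by
          rw [Real.log_prod fun i hi => (hp i (by simpa [Nat.lt_succ_iff] using hi)).2.ne',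
            Real.log_prod fun i hi => (hp i (by simpa [Nat.lt_succ_iff] using hi)).1.ne',
            ← Finset.sum_sub_distrib]
          refine Finset.sum_congr rfl fun i hi => ?_
          simp only [ha]
          rw [if_pos (hp i (by simpa [Nat.lt_succ_iff] using hi)).1]
        rw [e, sub_nonneg]
        exact Real.log_le_log
          (Finset.prod_pos fun i hi => (hp i (by simpa [Nat.lt_succ_iff] using hi)).1) (h _ hk)
      · rw [Finset.sum_range_succ]
        simpa [ha, hxk] using ih (by omega)
  have hw : Antitone fun i => c i * x i := fun i j hij =>
    mul_le_mul (hc hij) (hx hij) (hx0 j) (hc0 i)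
  have h1 := Finset.sum_range_mul_nonneg_of_antitone hw
    (fun i => mul_nonneg (hc0 i) (hx0 i)) hA
  rw [← sub_nonneg, ← Finset.sum_sub_distrib]
  refine h1.trans (Finset.sum_le_sum fun i hi => ?_)
  rw [← mul_sub, mul_assoc]
  refine mul_le_mul_of_nonneg_left ?_ (hc0 i)
  by_cases hxi : 0 < x i
  · have hyi := (hypos i (by simpa using hi) hxi i le_rfl).2
    simp only [ha, if_pos hxi]
    rw [← Real.log_div hyi.ne' hxi.ne']
    calc x i * Real.log (y i / x i) ≤ x i * (y i / x i - 1) :=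
          mul_le_mul_of_nonneg_left (Real.log_le_sub_one_of_pos (by positivity)) hxi.le
      _ = y i - x i := by field_simp
  · have : x i = 0 := le_antisymm (not_lt.1 hxi) (hx0 i)
    simp [this, hy0 i]

/-- The extension of a finite sequence by `0`. -/
def Fin.extendZero {n : ℕ} (f : Fin n → ℝ) (k : ℕ) : ℝ := if h : k < n then f ⟨k, h⟩ else 0

theorem Fin.extendZero_nonneg {n : ℕ} {f : Fin n → ℝ} (hf : ∀ i, 0 ≤ f i) (k : ℕ) :
    0 ≤ Fin.extendZero f k := by
  unfold Fin.extendZero; split_ifs <;> simp [hf]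

theorem Fin.extendZero_antitone {n : ℕ} {f : Fin n → ℝ} (hf : ∀ i, 0 ≤ f i) (ha : Antitone f) :
    Antitone (Fin.extendZero f) := by
  intro i j hij
  by_cases hj : j < n
  · simp only [Fin.extendZero, dif_pos hj, dif_pos (hij.trans_lt hj)]
    exact ha hij
  · simpa [Fin.extendZero, hj] using Fin.extendZero_nonneg hf i

@[simp]
theorem Fin.extendZero_val {n : ℕ} (f : Fin n → ℝ) (i : Fin n) : Fin.extendZero f i = f i := by
  simp [Fin.extendZero]

theorem Fin.sum_mul_le_of_prod_le {n : ℕ} {c x y : Fin n → ℝ} (hc : Antitone c)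
    (hc0 : ∀ i, 0 ≤ c i) (hx : Antitone x) (hx0 : ∀ i, 0 ≤ x i) (hy0 : ∀ i, 0 ≤ y i)
    (h : ∀ k (hk : k ≤ n), ∏ j : Fin k, x (Fin.castLE hk j) ≤ ∏ j : Fin k, y (Fin.castLE hk j)) :
    ∑ i, c i * x i ≤ ∑ i, c i * y i := by
  have := Finset.sum_range_mul_le_of_prod_le (n := n) (Fin.extendZero_antitone hc0 hc)
    (Fin.extendZero_nonneg hc0) (Fin.extendZero_antitone hx0 hx)
    (Fin.extendZero_nonneg hx0) (Fin.extendZero_nonneg hy0) (by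
      intro k hk
      rw [Finset.prod_range, Finset.prod_range]
      have e : ∀ (f : Fin n → ℝ) (j : Fin k), Fin.extendZero f j = f (Fin.castLE hk j) :=
        fun f j => Fin.extendZero_val f (Fin.castLE hk j)
      simpa only [e] using h k hk)
  simpa [Finset.sum_range] using this

theorem exists_perm_antitone_comp {n : ℕ} (f : Fin n → ℝ) :
    ∃ σ : Equiv.Perm (Fin n), Antitone (f ∘ σ) := by
  refine ⟨Tuple.sort (fun i => -f i), fun i j hij => ?_⟩
  have := Tuple.monotone_sort (fun i => -f i) hij
  simpa using this

/-- By rearrangement the left side is largest when `|c|` and `x` are sorted alike; `ρ` matches the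
order of `|c|` with that of `y`. -/
theorem exists_perm_sum_mul_le {n : ℕ} (c : Fin n → ℝ) {x y : Fin n → ℝ}
    (hx0 : ∀ i, 0 ≤ x i) (hy0 : ∀ i, 0 ≤ y i) (τ : Equiv.Perm (Fin n))
    (h : ∀ k (hk : k ≤ n) (e : Fin k ↪ Fin n),
      ∏ j : Fin k, x (e j) ≤ ∏ j : Fin k, y (τ (Fin.castLE hk j))) :
    ∃ ρ : Equiv.Perm (Fin n), ∑ i, c i * x i ≤ ∑ i, |c i| * y (ρ i) := by
  obtain ⟨σ, hσ⟩ := exists_perm_antitone_comp x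
  obtain ⟨π, hπ⟩ := exists_perm_antitone_comp fun i => |c i|
  refine ⟨π.symm.trans τ, ?_⟩
  calc ∑ i, c i * x i ≤ ∑ i, |c i| * x i :=
        Finset.sum_le_sum fun i _ => mul_le_mul_of_nonneg_right (le_abs_self _) (hx0 i)
    _ = ∑ i, |c (π i)| * x (π i) := (Equiv.sum_comp π fun i => |c i| * x i).symm
    _ = ∑ i, |c (π i)| * (x ∘ σ) ((π.trans σ.symm) i) := by simp
    _ ≤ ∑ i, |c (π i)| * (x ∘ σ) i := by
        have hm : Monovary (fun i => |c (π i)|) (x ∘ σ) := fun i j hij => by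
          by_contra hcon
          have hij' : j < i := by
            by_contra hji
            exact absurd (hσ (not_lt.1 hji)) (not_le.2 hij)
          exact hcon (hπ hij'.le)
        exact hm.sum_mul_comp_perm_le_sum_mul
    _ ≤ ∑ i, |c (π i)| * (y ∘ τ) i :=
        Fin.sum_mul_le_of_prod_le hπ (fun i => abs_nonneg _) hσ (fun i => hx0 _) (fun i => hy0 _)
          fun k hk => h k hk ((Fin.castLEEmb hk).trans σ.toEmbedding)
    _ = ∑ i, |c i| * y ((π.symm.trans τ) i) := by
        rw [← Equiv.sum_comp π fun i => |c i| * y ((π.symm.trans τ) i)]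
        simp

/-- The vectors obtained from `y` by permuting coordinates and changing signs. -/
def signedPerms {n : ℕ} (y : Fin n → ℝ) : Set (Fin n → ℝ) :=
  Set.range fun p : Equiv.Perm (Fin n) × (Fin n → ℤˣ) => fun i => ((p.2 i : ℤ) : ℝ) * y (p.1 i)

theorem mem_convexHull_signedPerms {n : ℕ} {x y : Fin n → ℝ}
    (hx0 : ∀ i, 0 ≤ x i) (hy0 : ∀ i, 0 ≤ y i) (τ : Equiv.Perm (Fin n))
    (h : ∀ k (hk : k ≤ n) (e : Fin k ↪ Fin n),
      ∏ j : Fin k, x (e j) ≤ ∏ j : Fin k, y (τ (Fin.castLE hk j))) :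
    x ∈ convexHull ℝ (signedPerms y) := by
  by_contra hx
  obtain ⟨f, u, hu, hfx⟩ := geometric_hahn_banach_closed_point (convex_convexHull ℝ _)
    ((Set.finite_range _).isClosed_convexHull ℝ) hx
  have hf : ∀ v : Fin n → ℝ, f v = ∑ i, f (Pi.single i 1) * v i := fun v => by
    conv_lhs => rw [← Finset.univ_sum_single v]
    rw [map_sum]
    refine Finset.sum_congr rfl fun i _ => ?_
    have : Pi.single i (v i) = v i • (Pi.single i 1 : Fin n → ℝ) := by
      rw [← Pi.single_smul]; simp
    rw [this, map_smul, smul_eq_mul, mul_comm]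
  obtain ⟨ρ, hρ⟩ := exists_perm_sum_mul_le (fun i => f (Pi.single i 1)) hx0 hy0 τ h
  -- Signs that turn the separating functional's coefficients into their absolute values.
  set ε : Fin n → ℤˣ := fun i => if 0 ≤ f (Pi.single i 1) then 1 else -1
  have h1 := hu _ (subset_convexHull ℝ _ ⟨(ρ, ε), rfl⟩)
  rw [hf] at hfx h1
  refine (lt_irrefl u) (hfx.trans_le (hρ.trans (le_of_eq_of_le ?_ h1.le)))
  refine Finset.sum_congr rfl fun i _ => ?_
  simp only [ε]
  split_ifs with h0
  · rw [abs_of_nonneg h0]; simp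
  · rw [abs_of_neg (not_le.1 h0)]; simp

namespace Matrix

/-! ### Log-majorization from a positive block matrix -/

section Compression

variable {m : Type*} [Fintype m] [DecidableEq m]

/-- Raising the eigenvalues of `P` to at least `t` makes it invertible and bounded below by `t`. The
principal minor on `s` then costs a factor `t ^ (card m - card s)`, which cancels exactly against
the eigenvalues outside `T`. -/
theorem prod_abs_le_prod_max {P W : Matrix m m ℂ} {d v : m → ℝ} (hW : W ∈ unitaryGroup m ℂ)
    (hP : P = W * diagonal (fun i => (v i : ℂ)) * star W)
    (hb : (fromBlocks P (diagonal fun i => (d i : ℂ)) (diagonal fun i => (d i : ℂ))ᴴ P).PosSemidef)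
    {t : ℝ} (ht : 0 < t) {s T : Finset m} (hc : T.card = s.card) (hT : ∀ i ∉ T, v i ≤ t) :
    ∏ i ∈ s, |d i| ≤ ∏ i ∈ T, max (v i) t := by
  set P' := W * diagonal (fun i => ((max (v i) t : ℝ) : ℂ)) * star W with hP'
  have hWW : W * star W = 1 := mem_unitaryGroup_iff.1 hW
  have hsub : (P' - P).PosSemidef := by
    rw [hP', hP, ← sub_mul, ← mul_sub, diagonal_sub]
    refine (PosSemidef.diagonal fun i => ?_).mul_mul_conjTranspose_same W
    simp only [Pi.zero_apply]
    rw [← Complex.ofReal_sub]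
    exact_mod_cast sub_nonneg.2 (le_max_left _ _)
  have hst : (P' - (t : ℂ) • 1).PosSemidef := by
    have : (t : ℂ) • (1 : Matrix m m ℂ) = W * diagonal (fun _ => (t : ℂ)) * star W := by
      rw [← smul_one_eq_diagonal, mul_smul_comm, mul_one, smul_mul_assoc, hWW]
    rw [hP', this, ← sub_mul, ← mul_sub, diagonal_sub]
    refine (PosSemidef.diagonal fun i => ?_).mul_mul_conjTranspose_same W
    simp only [Pi.zero_apply]
    rw [← Complex.ofReal_sub]
    exact_mod_cast sub_nonneg.2 (le_max_right _ _)
  have hpd : P'.PosDef := by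
    have h1 : ((t : ℂ) • (1 : Matrix m m ℂ)).PosDef := PosDef.one.smul (by exact_mod_cast ht)
    simpa using h1.add_posSemidef hst
  have hdet : P'.det = ((∏ i, max (v i) t : ℝ) : ℂ) := by
    have h1 : W.det * (star W).det = 1 := by rw [← det_mul, hWW, det_one]
    rw [hP', det_mul, det_mul, mul_right_comm, h1, one_mul, det_diagonal]
    push_cast; rfl
  have hb' : (fromBlocks P' (diagonal fun i => (d i : ℂ))
      (diagonal fun i => (d i : ℂ))ᴴ P').PosSemidef := by
    have h1 : (fromBlocks (P' - P) 0 0 (P' - P)).PosSemidef := by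
      obtain ⟨B, hB⟩ := CStarAlgebra.nonneg_iff_eq_star_mul_self.mp hsub.nonneg
      have := posSemidef_conjTranspose_mul_self (fromBlocks B 0 0 B)
      rw [fromBlocks_conjTranspose, fromBlocks_multiply] at this
      simpa [hB, star_eq_conjTranspose] using this
    have := hb.add h1
    rwa [fromBlocks_add, add_sub_cancel, add_zero, add_zero] at this
  have h1 := norm_det_le_of_fromBlocks_posSemidef
    (hpd.submatrix (Subtype.val_injective (p := (· ∈ s))))
    (D := diagonal fun i : s => (d i : ℂ)) (by
      convert hb'.submatrix (Sum.map ((↑) : s → m) ((↑) : s → m)) using 1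
      have hD : (diagonal fun i : s => (d i : ℂ)) =
          (diagonal fun i => (d i : ℂ)).submatrix ((↑) : s → m) (↑) :=
        (submatrix_diagonal (fun i => (d i : ℂ)) ((↑) : s → m) Subtype.val_injective).symm
      rw [hD, conjTranspose_submatrix]
      ext (i | i) (j | j) <;> rfl)
  have h2 := hpd.det_submatrix_mul_pow_le ht.le hst s
  have h3 : (((∏ i ∈ s, |d i|) * t ^ (Fintype.card m - s.card) : ℝ) : ℂ) ≤
      ((∏ i, max (v i) t : ℝ) : ℂ) := by
    rw [← hdet]
    refine le_trans ?_ h2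
    push_cast
    refine mul_le_mul_of_nonneg_right (le_of_eq_of_le ?_ h1)
      (pow_nonneg (by exact_mod_cast ht.le) _)
    rw [det_diagonal, norm_prod, Finset.prod_coe_sort s fun i => ‖(d i : ℂ)‖]
    simp
  have h4 : (∏ i ∈ s, |d i|) * t ^ (Fintype.card m - s.card) ≤ ∏ i, max (v i) t := by
    exact_mod_cast h3
  rw [← Finset.prod_mul_prod_compl T] at h4
  have h5 : ∏ i ∈ Tᶜ, max (v i) t = t ^ (Fintype.card m - s.card) := by
    rw [Finset.prod_congr rfl fun i hi => max_eq_right (hT i (by simpa using hi)),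
      Finset.prod_const, Finset.card_compl, hc]
  rw [h5] at h4
  exact le_of_mul_le_mul_right h4 (pow_pos ht _)

/-- If `P` dominates a diagonal matrix `D` in the sense that `[P, D; D, P]` is positive
semidefinite, then `|D|` is weakly log-majorized by the spectrum of `P`. -/
theorem prod_abs_le_prod_of_antitone {n : ℕ} {P W : Matrix (Fin n) (Fin n) ℂ} {d v : Fin n → ℝ}
    (hW : W ∈ unitaryGroup (Fin n) ℂ)
    (hP : P = W * diagonal (fun i => (v i : ℂ)) * star W) (hv : ∀ i, 0 ≤ v i)
    (hb : (fromBlocks P (diagonal fun i => (d i : ℂ)) (diagonal fun i => (d i : ℂ))ᴴ P).PosSemidef)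
    {τ : Equiv.Perm (Fin n)} (hτ : Antitone (v ∘ τ)) (k : ℕ) (hk : k ≤ n) (e : Fin k ↪ Fin n) :
    ∏ j : Fin k, |d (e j)| ≤ ∏ j : Fin k, v (τ (Fin.castLE hk j)) := by
  rcases Nat.eq_zero_or_pos k with rfl | hk0
  · simp
  set g : Fin k ↪ Fin n := (Fin.castLEEmb hk).trans τ.toEmbedding
  -- `v (g l)` is the `k`-th largest eigenvalue. It may be zero, so the threshold is `v (g l) + ε`,
  -- with `ε → 0` at the end.
  set l : Fin k := ⟨k - 1, by omega⟩
  have hg : ∀ j, g j = τ (Fin.castLE hk j) := fun _ => rfl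
  have hmin : ∀ j, v (g l) ≤ v (g j) := fun j => by
    refine hτ (a := Fin.castLE hk j) (b := Fin.castLE hk l) ?_
    rw [Fin.le_def]
    simp only [Fin.val_castLE, l]
    omega
  have hout : ∀ i ∉ Finset.univ.map g, v i ≤ v (g l) := fun i hi => by
    obtain ⟨i, rfl⟩ := τ.surjective i
    refine hτ (a := Fin.castLE hk l) (b := i) ?_
    rw [Fin.le_def]
    simp only [Fin.val_castLE, l]
    by_contra hlt
    exact hi (Finset.mem_map.2 ⟨⟨i, by omega⟩, Finset.mem_univ _, rfl⟩)
  have key : ∀ ε > 0, ∏ j : Fin k, |d (e j)| ≤ ∏ j : Fin k, max (v (g j)) (v (g l) + ε) := by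
    intro ε hε
    have := prod_abs_le_prod_max hW hP hb (t := v (g l) + ε)
      (add_pos_of_nonneg_of_pos (hv _) hε) (s := Finset.univ.map e) (T := Finset.univ.map g)
      (by simp) (fun i hi => (hout i hi).trans (by linarith))
    simpa [Finset.prod_map] using this
  have hlim : Filter.Tendsto (fun ε : ℝ => ∏ j : Fin k, max (v (g j)) (v (g l) + ε))
      (nhdsWithin 0 (Set.Ioi 0)) (nhds (∏ j : Fin k, v (g j))) := by
    have hcont : Continuous fun ε : ℝ => ∏ j : Fin k, max (v (g j)) (v (g l) + ε) := by fun_prop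
    have := (hcont.tendsto 0).mono_left (nhdsWithin_le_nhds (s := Set.Ioi 0))
    simpa [max_eq_left (hmin _)] using this
  exact ge_of_tendsto hlim (Filter.eventually_of_mem self_mem_nhdsWithin fun ε hε => key ε hε)

end Compression

end Matrix

/-! ### Unitarily invariant norms -/

section Norm

open Matrix

variable {n : ℕ} {N : Seminorm ℂ (Matrix (Fin n) (Fin n) ℂ)}

theorem IsUnitarilyInvariantNorm.map_conj (hN : IsUnitarilyInvariantNorm N)
    {U : Matrix (Fin n) (Fin n) ℂ} (hU : U ∈ unitaryGroup (Fin n) ℂ)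
    (M : Matrix (Fin n) (Fin n) ℂ) : N (U * M * star U) = N M :=
  hN.map_unitary_mul_mul U hU (star U) (Unitary.star_mem hU) M

theorem IsUnitarilyInvariantNorm.map_diagonal_perm (hN : IsUnitarilyInvariantNorm N)
    (ρ : Equiv.Perm (Fin n)) (y : Fin n → ℂ) : N (diagonal (y ∘ ρ)) = N (diagonal y) := by
  set U : Matrix (Fin n) (Fin n) ℂ := (1 : Matrix (Fin n) (Fin n) ℂ).submatrix ρ id with hUdef
  have hUs : star U = (1 : Matrix (Fin n) (Fin n) ℂ).submatrix id ρ := by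
    rw [star_eq_conjTranspose, hUdef, conjTranspose_submatrix, conjTranspose_one]
  have hU : U ∈ unitaryGroup (Fin n) ℂ := by
    rw [mem_unitaryGroup_iff, hUs, hUdef, ← submatrix_mul _ _ _ _ _ Function.bijective_id, one_mul,
      submatrix_one_equiv]
  rw [← hN.map_conj hU (diagonal y)]
  congr 1
  have h1 : (diagonal y).submatrix id id = diagonal y := submatrix_id_id _
  rw [hUs, hUdef, ← h1, ← submatrix_mul _ _ _ _ _ Function.bijective_id,
    ← submatrix_mul _ _ _ _ _ Function.bijective_id, one_mul, mul_one, submatrix_diagonal_equiv]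

theorem IsUnitarilyInvariantNorm.map_diagonal_sign (hN : IsUnitarilyInvariantNorm N)
    (ε : Fin n → ℤˣ) (y : Fin n → ℂ) :
    N (diagonal fun i => ((ε i : ℤ) : ℂ) * y i) = N (diagonal y) := by
  have hU : (diagonal fun i => ((ε i : ℤ) : ℂ)) ∈ unitaryGroup (Fin n) ℂ := by
    rw [mem_unitaryGroup_iff, star_eq_conjTranspose, diagonal_conjTranspose, diagonal_mul_diagonal,
      ← diagonal_one]
    congr 1
    ext i
    rcases Int.units_eq_one_or (ε i) with h | h <;> simp [h]
  have := hN.map_unitary_mul_mul _ hU 1 (one_mem _) (diagonal y)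
  rwa [mul_one, diagonal_mul_diagonal] at this

/-- **Fan dominance** on diagonal matrices, in the form of convex hulls. -/
theorem IsUnitarilyInvariantNorm.map_diagonal_le (hN : IsUnitarilyInvariantNorm N)
    {x y : Fin n → ℝ} (h : x ∈ convexHull ℝ (signedPerms y)) :
    N (diagonal fun i => (x i : ℂ)) ≤ N (diagonal fun i => (y i : ℂ)) := by
  have hconv : Convex ℝ {z : Fin n → ℝ |
      N (diagonal fun i => (z i : ℂ)) ≤ N (diagonal fun i => (y i : ℂ))} := by
    intro z hz w hw a b ha hb hab
    have e : (diagonal fun i => (((a • z + b • w) i : ℝ) : ℂ)) =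
        (a : ℂ) • (diagonal fun i => (z i : ℂ)) + (b : ℂ) • diagonal fun i => (w i : ℂ) := by
      ext i j
      by_cases hij : i = j
      · subst hij; simp
      · simp [hij]
    simp only [Set.mem_ofPred_eq] at hz hw ⊢
    rw [e]
    refine (map_add_le_add N _ _).trans ?_
    rw [map_smul_eq_mul, map_smul_eq_mul, Complex.norm_of_nonneg ha, Complex.norm_of_nonneg hb]
    calc _ ≤ a * N (diagonal fun i => (y i : ℂ)) + b * N (diagonal fun i => (y i : ℂ)) := by gcongr
      _ = _ := by rw [← add_mul, hab, one_mul]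
  refine convexHull_min ?_ hconv h
  rintro _ ⟨⟨ρ, ε⟩, rfl⟩
  have := (hN.map_diagonal_sign ε ((fun i => (y i : ℂ)) ∘ ρ)).trans (hN.map_diagonal_perm ρ _)
  simpa [Function.comp_def] using this.le

theorem IsUnitarilyInvariantNorm.map_cfc (hN : IsUnitarilyInvariantNorm N)
    {H : Matrix (Fin n) (Fin n) ℂ} (hH : H.IsHermitian) (f : ℝ → ℝ) :
    N (cfc f H) = N (diagonal fun i => (f (hH.eigenvalues i) : ℂ)) := by
  rw [hH.cfc_eq, IsHermitian.cfc, Unitary.conjStarAlgAut_apply]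
  exact hN.map_conj (U := (hH.eigenvectorUnitary : Matrix (Fin n) (Fin n) ℂ))
    (SetLike.coe_mem _) _

theorem Matrix.IsHermitian.abs_rpow_eq_cfc {H : Matrix (Fin n) (Fin n) ℂ} (hH : H.IsHermitian)
    {α : ℝ} (hα : 0 < α) : CFC.abs H ^ α = cfc (fun x : ℝ => |x| ^ α) H := by
  have hs : IsSelfAdjoint H := hH
  rw [CFC.rpow_eq_cfc_real (CFC.abs_nonneg H), CFC.abs_eq_cfc_norm H hs]
  rw [← cfc_comp' (fun x : ℝ => x ^ α) (fun x : ℝ => ‖x‖) H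
    ((Real.continuous_rpow_const hα.le).continuousOn)]
  simp [Real.norm_eq_abs]

/-- If `[P, H; H, P]` is positive semidefinite with `H` Hermitian, then `|H|^α` is dominated by
`P^α` in every unitarily invariant norm. -/
theorem IsUnitarilyInvariantNorm.map_abs_rpow_le (hN : IsUnitarilyInvariantNorm N)
    {P H : Matrix (Fin n) (Fin n) ℂ} (hH : H.IsHermitian) (hb : (fromBlocks P H H P).PosSemidef)
    {α : ℝ} (hα : 0 < α) : N (CFC.abs H ^ α) ≤ N (P ^ α) := by
  have hP : P.PosSemidef := hb.submatrix Sum.inl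
  rw [hH.abs_rpow_eq_cfc hα, CFC.rpow_eq_cfc_real hP.nonneg, hN.map_cfc hH, hN.map_cfc hP.1]
  set U : Matrix (Fin n) (Fin n) ℂ := hH.eigenvectorUnitary.1
  set W : Matrix (Fin n) (Fin n) ℂ := hP.1.eigenvectorUnitary.1
  have hU : U ∈ unitaryGroup (Fin n) ℂ := SetLike.coe_mem _
  have hW : W ∈ unitaryGroup (Fin n) ℂ := SetLike.coe_mem _
  have hHU : star U * H * U = diagonal fun i => (hH.eigenvalues i : ℂ) := by
    have := hH.conjStarAlgAut_star_eigenvectorUnitary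
    rwa [Unitary.conjStarAlgAut_star_apply] at this
  have hPW : P = W * diagonal (fun i => (hP.1.eigenvalues i : ℂ)) * star W := by
    have := hP.1.spectral_theorem
    rwa [Unitary.conjStarAlgAut_apply] at this
  have hPW' : star U * P * U = (star U * W) * diagonal (fun i => (hP.1.eigenvalues i : ℂ)) *
      star (star U * W) := by
    rw [star_mul, star_star]
    conv_lhs => rw [hPW]
    simp only [mul_assoc]
  -- Conjugation by `U ⊕ U` diagonalizes `H` and keeps both diagonal blocks equal.
  have hb' : (fromBlocks (star U * P * U) (diagonal fun i => (hH.eigenvalues i : ℂ))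
      (diagonal fun i => (hH.eigenvalues i : ℂ))ᴴ (star U * P * U)).PosSemidef := by
    have h1 := hb.conjTranspose_mul_mul_same (fromBlocks U 0 0 U)
    rw [fromBlocks_conjTranspose, fromBlocks_multiply, fromBlocks_multiply] at h1
    rw [← hHU]
    simpa [star_eq_conjTranspose, hH.eq, mul_assoc] using h1
  have hv := hP.eigenvalues_nonneg
  obtain ⟨τ, hτ⟩ := exists_perm_antitone_comp hP.1.eigenvalues
  refine hN.map_diagonal_le (mem_convexHull_signedPerms (fun i => by positivity)
    (fun i => Real.rpow_nonneg (hv i) _) τ fun k hk e => ?_)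
  rw [Real.finsetProd_rpow _ _ fun i _ => abs_nonneg _, Real.finsetProd_rpow _ _ fun i _ => hv _]
  exact Real.rpow_le_rpow (Finset.prod_nonneg fun i _ => abs_nonneg _)
    (prod_abs_le_prod_of_antitone (mul_mem (Unitary.star_mem hU) hW) hPW' hv hb' hτ k hk e) hα.le

end Norm

theorem corollary3p3 (n : ℕ) (A B X : Matrix (Fin n) (Fin n) ℂ)
    (h : (Matrix.fromBlocks A X Xᴴ B).PosSemidef) (d : MatrixOp) (α : ℝ) (hα : 0 < α)
    (N : Seminorm ℂ (Matrix (Fin n) (Fin n) ℂ)) (hN : IsUnitarilyInvariantNorm N) :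
    N (CFC.abs (d.apply X Xᴴ) ^ α) ≤ N (d.apply A B ^ α) := by
  -- Pairing with the swapped block matrix makes the off-diagonal block Hermitian and the diagonal
  -- blocks equal; the Schur case uses the Schur product theorem.
  have hswap : (Matrix.fromBlocks B Xᴴ X A).PosSemidef := by
    simpa using h.submatrix Sum.swap
  cases d with
  | sum =>
    refine hN.map_abs_rpow_le (Matrix.isHermitian_add_transpose_self X) ?_ hα
    simpa [MatrixOp.apply, Matrix.fromBlocks_add, add_comm] using h.add hswap
  | schur =>
    refine hN.map_abs_rpow_le (H := X ⊙ Xᴴ) ?_ ?_ hα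
    · ext i j
      simp [mul_comm]
    · have hs := h.hadamard hswap
      have e : Matrix.fromBlocks A X Xᴴ B ⊙ Matrix.fromBlocks B Xᴴ X A =
          Matrix.fromBlocks (A ⊙ B) (X ⊙ Xᴴ) (X ⊙ Xᴴ) (A ⊙ B) := by
        ext (i | i) (j | j) <;> simp [mul_comm]
      rwa [e] at hs
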